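/- A global projective flow on $\mathbb{R}^3$ is a map $\phi$ such that: (a) for every $\mathbf{x}\in\mathbb{R}^3$ the function $t\mapsto\phi(t\mathbf{x})$ is meromorphic on $\mathbb{R}$ (removable singularities being removed; $\phi$ is called regular at $\mathbf{x}$ if this function has no pole at $t=1$); (b) it satisfies the projective translation equation $$\frac{1}{t+s}\,\phi\big(\mathbf{x}(t+s)\big)=\frac1s\,\phi\Big(\phi(\mathbf{x}t)\frac st\Big),\qquad s,t,t+s\in\mathbb{R}\setminus\{0\},$$ whenever $\phi$ is regular at all the points involved; (c) $\lim_{t\to0}\phi(\mathbf{x}t)/t=\mathbf{x}$ for all $\mathbf{x}$. Its vector field is $\frac{d}{dt}\frac{\phi(\mathbf{x}t)}{t}\big|_{t=0}$. **Theorem.** A global projective flow $\phi$ with vector field $(yz,\,xz,\,xy)$ (the tetrahedral superflow) exists. Let $\phi$ be any such flow, and let $U(x,y,z)$ be its first coordinate. 1. Assume $x^2>z^2>y^2$, and put $v=\sqrt{x^2-y^2}$, $k=\sqrt{\frac{x^2-z^2}{x^2-y^2}}$. Then $$U(x,y,z)=\frac{x(x^2-y^2)\,\mathrm{sn}'(v;k)+yz\sqrt{x^2-y^2}\;\mathrm{sn}(v;k)}{x^2-y^2-x^2\,\mathrm{sn}^2(v;k)}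 ,$$ where $\mathrm{sn}(\,\cdot\,;k)$ is the Jacobi elliptic function of modulus $k$ and $\mathrm{sn}'$ is its derivative with respect to the first variable. 2. Assume $x^2>y^2$ and $z=x$. Then $$U(x,y,x)=\frac{x(x^2-y^2)\cos\sqrt{x^2-y^2}+xy\sqrt{x^2-y^2}\,\sin\sqrt{x^2-y^2}}{x^2\cos^2\sqrt{x^2-y^2}-y^2}.$$ In both cases this means: if the denominator is nonzero at the point, then $\phi$ is regular there and the formula holds; and wherever $\phi$ is regular, $U$ times the denominator equals the numerator. -/

import Mathlib

open Filter Topology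

noncomputable section

/-- The incomplete elliptic integral of the first kind with modulus `k`,
`F(θ; k) = ∫₀^θ dα / √(1 - k² sin² α)`. For `0 ≤ k < 1` it is an increasing bijection of `ℝ`. -/
def ellipticF (k θ : ℝ) : ℝ :=
  ∫ α in (0 : ℝ)..θ, 1 / √(1 - k ^ 2 * Real.sin α ^ 2)

/-- The Jacobi amplitude `am(u; k)`: the inverse function of `θ ↦ F(θ; k)`, for `0 ≤ k < 1`. -/
def jacobiAm (k u : ℝ) : ℝ := Function.invFun (ellipticF k) u

/-- The Jacobi elliptic function `sn(u; k) = sin (am(u; k))`, with modulus `k` (not `k²`). -/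
def jacobiSn (u k : ℝ) : ℝ := Real.sin (jacobiAm k u)

/-- The derivative of `sn(u; k)` with respect to its first variable. -/
def jacobiSn' (u k : ℝ) : ℝ := deriv (fun w => jacobiSn w k) u

/-- The points at which `φ` is regular along the line through the origin, i.e. where
`t ↦ φ (t • a)` has no pole at `t = 1`. For `t ≠ 0`, `t • a ∈ regularSet φ` iff
`r ↦ φ (r • a)` has no pole at `r = t`. -/
def regularSet {n : ℕ} (φ : (Fin n → ℝ) → (Fin n → ℝ)) : Set (Fin n → ℝ) :=
  {a | AnalyticAt ℝ (fun t : ℝ => φ (t • a)) 1}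

/-- Global (single-valued, meromorphic in time) projective flows on `ℝⁿ`.

A flow of a polynomial vector field may blow up in finite time, so `φ` is only meaningful on
`regularSet φ`: along each line through the origin `φ` is a meromorphic function of the
parameter, and `MeromorphicNFAt` says that `φ` takes the value `0` at the poles and has no
removable discontinuities. -/
structure IsGlobalProjectiveFlow {n : ℕ} (φ : (Fin n → ℝ) → (Fin n → ℝ)) : Prop where
  meromorphic : ∀ (a : Fin n → ℝ) (t : ℝ), MeromorphicNFAt (fun r : ℝ => φ (r • a)) t
  /-- The projective translation equation. -/
  translation : ∀ (a : Fin n → ℝ) (s t : ℝ), s ≠ 0 → t ≠ 0 → t + s ≠ 0 →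
    t • a ∈ regularSet φ → (t + s) • a ∈ regularSet φ →
    (s / t) • φ (t • a) ∈ regularSet φ →
    (1 / (t + s)) • φ ((t + s) • a) = (1 / s) • φ ((s / t) • φ (t • a))
  /-- The boundary condition (non-singularity). -/
  boundary : ∀ a : Fin n → ℝ, Tendsto (fun t : ℝ => (1 / t) • φ (t • a)) (𝓝[≠] 0) (𝓝 a)

/-- `Q` is the vector field of the projective flow `φ`: for each `a`, the function
`t ↦ φ (t a) / t`, extended by its limit `a` at `t = 0`, has derivative `Q a` at `t = 0`. -/
def HasVectorField {n : ℕ} (φ Q : (Fin n → ℝ) → (Fin n → ℝ)) : Prop :=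
  ∀ a : Fin n → ℝ,
    HasDerivAt (Function.update (fun t : ℝ => (1 / t) • φ (t • a)) 0 a) (Q a) 0

/-- The tetrahedral vector field `yz • xz • xy`. -/
def tetrahedralField (a : Fin 3 → ℝ) : Fin 3 → ℝ :=
  ![a 1 * a 2, a 0 * a 2, a 0 * a 1]

/-- The tetrahedral superflow: the global projective flow with vector field `yz • xz • xy`. -/
def IsTetrahedralSuperflow (φ : (Fin 3 → ℝ) → (Fin 3 → ℝ)) : Prop :=
  IsGlobalProjectiveFlow φ ∧ HasVectorField φ tetrahedralField

end

/-! Put `g t = φ (t • a) / t`. The projective translation equation says that `g` obeys the group law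
of a flow, so `φ` is a tetrahedral superflow exactly when each `g` is a meromorphic solution of x' =
yz, y' = xz, z' = xy starting at `a`. Such a solution is unique: Picard–Lindelöf fixes it near 0 and
the identity theorem carries it across the poles.

It remains to solve the system. The quantities x² - y² and x² - z² are conserved, and functions with
S' = CE, C² = 1 - (x² - y²)S², E² = 1 - (x² - z²)S² (rescaled sn, cn, dn) give a particular solution
-(1, C, E)/S with the same invariants. Translating it by the addition theorem suggests an explicit
quotient with denominator 1 - x²S² (`IsEllipticTriple.isSolutionFraction`), which is checked
directly. At time 1 it gives both formulas; after a cyclic permutation putting the largest square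
first, it gives existence. -/

/-! ### Meromorphic solutions of the differential equation -/

/-- `g` solves `g' = tetrahedralField g` near `0` with `g 0 = a`, and is meromorphic on `ℝ`, in
normal form. -/
structure IsMeromorphicSolution (g : ℝ → Fin 3 → ℝ) (a : Fin 3 → ℝ) : Prop where
  meromorphicNFAt : ∀ t, MeromorphicNFAt g t
  analyticAt_zero : AnalyticAt ℝ g 0
  apply_zero : g 0 = a
  hasDerivAt : ∀ᶠ t in 𝓝 0, HasDerivAt g (tetrahedralField (g t)) t

lemma tetrahedralField_apply (a : Fin 3 → ℝ) (i : Fin 3) :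
    tetrahedralField a i = a (i + 1) * a (i + 2) := by
  fin_cases i <;> simp [tetrahedralField, mul_comm]

lemma tetrahedralField_smul (c : ℝ) (a : Fin 3 → ℝ) :
    tetrahedralField (c • a) = c ^ 2 • tetrahedralField a := by
  ext i
  simp only [tetrahedralField_apply, Pi.smul_apply, smul_eq_mul]
  ring

lemma contDiff_tetrahedralField : ContDiff ℝ 1 tetrahedralField := by
  rw [contDiff_pi]
  intro i
  simp only [tetrahedralField_apply]
  fun_prop

lemma tetrahedralField_solution_unique {g h : ℝ → Fin 3 → ℝ}
    (hg : ∀ᶠ t in 𝓝 0, HasDerivAt g (tetrahedralField (g t)) t)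
    (hh : ∀ᶠ t in 𝓝 0, HasDerivAt h (tetrahedralField (h t)) t) (h0 : g 0 = h 0) :
    g =ᶠ[𝓝 0] h := by
  obtain ⟨K, s, hs, hK⟩ :=
    (contDiff_tetrahedralField.contDiffAt (x := g 0)).exists_lipschitzOnWith
  refine ODE_solution_unique_of_eventually (v := fun _ => tetrahedralField) (s := fun _ => s)
    (K := K) (Eventually.of_forall fun _ => hK) ?_ ?_ h0
  · exact hg.and (hg.self_of_nhds.continuousAt.eventually_mem hs)
  · exact hh.and (hh.self_of_nhds.continuousAt.eventually_mem (h0 ▸ hs))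

/-- Identity theorem: infinite order at one point propagates because ℝ is connected. This is what
carries local identities past poles. -/
lemma eventuallyEq_zero_of_meromorphic {E : Type*} [NormedAddCommGroup E] [NormedSpace ℝ E]
    {f : ℝ → E} (hf : ∀ t, MeromorphicAt f t) {u : ℝ} (h : f =ᶠ[𝓝 u] 0) (t : ℝ) :
    f =ᶠ[𝓝[≠] t] 0 := by
  have hf' : MeromorphicOn f Set.univ := fun t _ => hf t
  have key := fun ht => hf'.meromorphicOrderAt_ne_top_of_isPreconnected isPreconnected_univ
    (Set.mem_univ t) (Set.mem_univ u) ht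
  have hu : meromorphicOrderAt f u = ⊤ :=
    meromorphicOrderAt_eq_top_iff.2 (h.filter_mono nhdsWithin_le_nhds)
  exact meromorphicOrderAt_eq_top_iff.1 (by_contra fun ht => key ht hu)

lemma MeromorphicAt.apply {ι : Type*} [Fintype ι] {f : ℝ → ι → ℝ} {t : ℝ}
    (hf : MeromorphicAt f t) (i : ι) : MeromorphicAt (fun r => f r i) t := by
  obtain ⟨n, hn⟩ := hf
  exact ⟨n, (analyticAt_pi_iff.1 hn i)⟩

namespace IsMeromorphicSolution

variable {g h : ℝ → Fin 3 → ℝ} {a : Fin 3 → ℝ}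

lemma meromorphicAt (hg : IsMeromorphicSolution g a) (t : ℝ) : MeromorphicAt g t :=
  (hg.meromorphicNFAt t).meromorphicAt

lemma unique (hg : IsMeromorphicSolution g a) (hh : IsMeromorphicSolution h a) : g = h := by
  have h0 := tetrahedralField_solution_unique hg.hasDerivAt hh.hasDerivAt
    (hg.apply_zero.trans hh.apply_zero.symm)
  ext1 t
  have h1 : g - h =ᶠ[𝓝[≠] t] 0 := eventuallyEq_zero_of_meromorphic
    (fun t => (hg.meromorphicAt t).sub (hh.meromorphicAt t)) (u := 0)
    (h0.mono fun t ht => by simp [ht]) t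
  have h2 : g =ᶠ[𝓝[≠] t] h := h1.mono fun t ht => sub_eq_zero.1 ht
  -- Normal form upgrades equality near `t` to equality at `t`, poles included.
  exact (((hg.meromorphicNFAt t).eventuallyEq_nhdsNE_iff_eventuallyEq_nhds
    (hh.meromorphicNFAt t)).1 h2).self_of_nhds

/-- The defect of the equation is meromorphic and vanishes near 0, hence near every point, and by
continuity at any point of analyticity. -/
lemma hasDerivAt_of_analyticAt (hg : IsMeromorphicSolution g a) {t : ℝ} (ht : AnalyticAt ℝ g t) :
    HasDerivAt g (tetrahedralField (g t)) t := by
  have key : ∀ i, deriv g t i = tetrahedralField (g t) i := by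
    intro i
    have hz : (fun r => deriv g r i - g r (i + 1) * g r (i + 2)) =ᶠ[𝓝[≠] t] 0 := by
      refine eventuallyEq_zero_of_meromorphic (u := 0) (fun r => ?_) ?_ t
      · exact ((hg.meromorphicAt r).deriv.apply i).sub
          (((hg.meromorphicAt r).apply _).mul ((hg.meromorphicAt r).apply _))
      · filter_upwards [hg.hasDerivAt] with r hr
        simp [hr.deriv, tetrahedralField_apply]
    have hc : ContinuousAt (fun r => deriv g r i - g r (i + 1) * g r (i + 2)) t := by
      have h1 := continuousAt_pi.1 ht.deriv.continuousAt
      have h2 := continuousAt_pi.1 ht.continuousAt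
      exact (h1 i).sub ((h2 _).mul (h2 _))
    have := (hc.eventuallyEq_nhds_iff_eventuallyEq_nhdsNE continuousAt_const).1 hz
    rw [tetrahedralField_apply]
    exact sub_eq_zero.1 this.self_of_nhds
  rw [← funext key]
  exact ht.differentiableAt.hasDerivAt

/-- The system is autonomous; together with `unique` this yields the translation equation. -/
lemma comp_const_add (hg : IsMeromorphicSolution g a) {t : ℝ} (ht : AnalyticAt ℝ g t) :
    IsMeromorphicSolution (fun s => g (t + s)) (g t) where
  meromorphicNFAt s :=
    (hg.meromorphicNFAt (t + s)).comp_analyticAt (g := fun s => t + s) (by fun_prop)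
  analyticAt_zero := by
    have h1 : AnalyticAt ℝ (fun s : ℝ => t + s) 0 := by fun_prop
    exact AnalyticAt.fun_comp (g := g) (by simpa using ht) h1
  apply_zero := by simp
  hasDerivAt := by
    have h1 : ∀ᶠ s in 𝓝 (0 : ℝ), AnalyticAt ℝ g (t + s) := by
      have : Tendsto (fun s : ℝ => t + s) (𝓝 0) (𝓝 t) := by
        simpa using (continuous_const_add t).tendsto 0
      exact this.eventually ht.eventually_analyticAt
    filter_upwards [h1] with s hs
    exact (hg.hasDerivAt_of_analyticAt hs).comp_const_add t s

/-- The field is homogeneous of degree 2. Together with `unique` this makes `g (t • a) 1 = t • g a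
t`. -/
lemma const_smul_comp_const_mul (hg : IsMeromorphicSolution g a) (c : ℝ) :
    IsMeromorphicSolution (fun t => c • g (c * t)) (c • a) where
  meromorphicNFAt t := by
    rcases eq_or_ne c 0 with rfl | hc
    · simpa using (analyticAt_const (v := (0 : Fin 3 → ℝ))).meromorphicNFAt
    · exact ((hg.meromorphicNFAt (c * t)).comp_analyticAt (g := fun t => c * t)
        (by fun_prop)).smul_analytic (g := fun _ => c) analyticAt_const hc
  analyticAt_zero := by
    have h1 : AnalyticAt ℝ (fun t : ℝ => c * t) 0 := by fun_prop
    exact (analyticAt_const (v := c)).smul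
      (AnalyticAt.fun_comp (g := g) (by simpa using hg.analyticAt_zero) h1)
  apply_zero := by simp [hg.apply_zero]
  hasDerivAt := by
    have h1 : Tendsto (fun s : ℝ => c * s) (𝓝 0) (𝓝 0) := by
      simpa using (continuous_const_mul c).tendsto 0
    filter_upwards [h1.eventually hg.hasDerivAt] with t ht
    have := (ht.scomp t (by simpa using (hasDerivAt_id t).const_mul c)).const_smul c
    rw [tetrahedralField_smul, pow_two, mul_smul]
    exact this

end IsMeromorphicSolution

/-! ### Superflows and meromorphic solutions -/

lemma smul_mem_regularSet_iff {n : ℕ} {φ : (Fin n → ℝ) → (Fin n → ℝ)} {a : Fin n → ℝ} {t : ℝ}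
    (ht : t ≠ 0) : t • a ∈ regularSet φ ↔ AnalyticAt ℝ (fun r : ℝ => φ (r • a)) t := by
  have hd : deriv (fun r : ℝ => r * t) 1 ≠ 0 := by simpa using ht
  have := analyticAt_comp_iff_of_deriv_ne_zero (f := fun r : ℝ => r * t)
    (g := fun r : ℝ => φ (r • a)) (x := 1) (by fun_prop) hd
  simpa [regularSet, smul_smul, Function.comp_def] using this

/-- A family of meromorphic solutions defines the tetrahedral superflow. -/
lemma exists_isTetrahedralSuperflow
    (H : ∀ a : Fin 3 → ℝ, ∃ g, IsMeromorphicSolution g a) :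
    ∃ φ : (Fin 3 → ℝ) → (Fin 3 → ℝ), IsTetrahedralSuperflow φ := by
  choose g hg using H
  have hscale : ∀ (a : Fin 3 → ℝ) (t : ℝ), g (t • a) 1 = t • g a t := fun a t => by
    rw [(hg (t • a)).unique ((hg a).const_smul_comp_const_mul t)]
    simp
  have hdiv : ∀ (a : Fin 3 → ℝ) (t : ℝ), t ≠ 0 → (1 / t) • g (t • a) 1 = g a t := fun a t ht => by
    rw [hscale, smul_smul, one_div_mul_cancel ht, one_smul]
  refine ⟨fun a => g a 1, ⟨?_, ?_, ?_⟩, ?_⟩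
  · intro a t
    simp only [hscale]
    rcases eq_or_ne t 0 with rfl | ht
    · exact (analyticAt_id.smul (hg a).analyticAt_zero).meromorphicNFAt
    · exact ((hg a).meromorphicNFAt t).smul_analytic analyticAt_id ht
  · intro a s t hs ht hts h1 _ _
    rw [smul_mem_regularSet_iff ht] at h1
    have ha : AnalyticAt ℝ (g a) t := by
      refine ((analyticAt_inv ht).smul h1).congr ?_
      filter_upwards [isOpen_ne.mem_nhds ht] with r hr
      simpa using hdiv a r hr
    have e : (s / t) • g (t • a) 1 = s • g a t := by
      rw [hscale, smul_smul, div_mul_cancel₀ _ ht]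
    rw [hdiv a _ hts, e, hdiv _ s hs, (hg (g a t)).unique ((hg a).comp_const_add ha)]
  · intro a
    have h1 : Tendsto (g a) (𝓝[≠] 0) (𝓝 a) := by
      have := (hg a).analyticAt_zero.continuousAt.tendsto
      rw [(hg a).apply_zero] at this
      exact this.mono_left nhdsWithin_le_nhds
    refine h1.congr' ?_
    filter_upwards [self_mem_nhdsWithin] with t ht
    exact (hdiv a t ht).symm
  · intro a
    have h1 : Function.update (fun t : ℝ => (1 / t) • g (t • a) 1) 0 a = g a := by
      ext1 t
      rcases eq_or_ne t 0 with rfl | ht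
      · simp [(hg a).apply_zero]
      · simp only [Function.update_of_ne ht, hdiv a t ht]
    rw [h1]
    have := (hg a).hasDerivAt.self_of_nhds
    rwa [(hg a).apply_zero] at this

/-- Along each line, a tetrahedral superflow is a meromorphic solution. -/
lemma IsTetrahedralSuperflow.isMeromorphicSolution {φ : (Fin 3 → ℝ) → (Fin 3 → ℝ)}
    (hφ : IsTetrahedralSuperflow φ) (a : Fin 3 → ℝ) :
    IsMeromorphicSolution (Function.update (fun t : ℝ => (1 / t) • φ (t • a)) 0 a) a := by
  obtain ⟨hF, hV⟩ := hφ
  set G : (Fin 3 → ℝ) → ℝ → Fin 3 → ℝ :=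
    fun a => Function.update (fun t : ℝ => (1 / t) • φ (t • a)) 0 a with hG
  have hG0 : ∀ b, G b 0 = b := fun b => by simp [hG]
  have hGne : ∀ b t, t ≠ 0 → G b t = (1 / t) • φ (t • b) := fun b t ht => by
    simp [hG, Function.update_of_ne ht]
  have hreg : ∀ b, ∀ᶠ t in 𝓝[≠] (0 : ℝ), t • b ∈ regularSet φ := fun b => by
    filter_upwards [(hF.meromorphic b 0).meromorphicAt.eventually_analyticAt,
      self_mem_nhdsWithin] with t ht ht0
    exact (smul_mem_regularSet_iff ht0).2 ht
  have hcont : ContinuousAt (G a) 0 := continuousAt_update_same.2 (hF.boundary a)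
  have hanal : AnalyticAt ℝ (G a) 0 := by
    -- A meromorphic function continuous at the point, here by the boundary condition, is analytic
    -- there.
    refine MeromorphicAt.analyticAt ?_ hcont
    refine ((MeromorphicAt.id (0 : ℝ)).inv.smul
      (hF.meromorphic a 0).meromorphicAt).congr ?_
    filter_upwards [self_mem_nhdsWithin] with t ht
    simp [hGne a t ht]
  refine ⟨fun t => ?_, hanal, hG0 a, ?_⟩
  · rcases eq_or_ne t 0 with rfl | ht
    · exact hanal.meromorphicNFAt
    · have h1 := (hF.meromorphic a t).smul_analytic (analyticAt_inv ht) (inv_ne_zero ht)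
      refine (meromorphicNFAt_congr ?_).2 h1
      filter_upwards [isOpen_ne.mem_nhds ht] with r hr
      change G a r = _
      simp [hGne a r hr]
  · change ∀ᶠ t in 𝓝 0, HasDerivAt (G a) (tetrahedralField (G a t)) t
    have h0 : HasDerivAt (G a) (tetrahedralField (G a 0)) 0 := by
      rw [hG0]; exact hV a
    have hne : ∀ᶠ t in 𝓝[≠] (0 : ℝ), HasDerivAt (G a) (tetrahedralField (G a t)) t := by
      filter_upwards [(hF.meromorphic a 0).meromorphicAt.eventually_analyticAt,
        self_mem_nhdsWithin] with t ht ht0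
      have ht0 : t ≠ 0 := ht0
      have hshift : Tendsto (fun s : ℝ => t + s) (𝓝 0) (𝓝 t) := by
        simpa using (continuous_const_add t).tendsto 0
      -- The translation equation as a group law: it moves the derivative at time 0, the only one
      -- the vector field provides, to time `t`.
      have key : (fun s => G a (t + s)) =ᶠ[𝓝 0] G (G a t) := by
        have hr := eventually_nhdsWithin_iff.1 (hreg (G a t))
        filter_upwards [hr, hshift.eventually ht.eventually_analyticAt,
          hshift.eventually (isOpen_ne.mem_nhds ht0)] with s hs hts hts0
        rcases eq_or_ne s 0 with rfl | hs0
        · simp [hG0]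
        · have e : (s / t) • φ (t • a) = s • G a t := by
            rw [hGne a t ht0, smul_smul, mul_one_div]
          rw [hGne _ _ hts0, hGne _ _ hs0, hF.translation a s t hs0 ht0 hts0
            ((smul_mem_regularSet_iff ht0).2 ht) ((smul_mem_regularSet_iff hts0).2 hts)
            (by rw [e]; exact hs hs0), e]
      have h1 : HasDerivAt (fun s => G a (t + s)) (tetrahedralField (G a t)) 0 :=
        (hV (G a t)).congr_of_eventuallyEq key
      have h2 : HasDerivAt (fun s => G a (t + s)) (tetrahedralField (G a t)) (t - t) := by
        rwa [sub_self]
      simpa using h2.comp_sub_const t t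
    rw [eventually_nhdsWithin_iff] at hne
    filter_upwards [hne] with t ht
    rcases eq_or_ne t 0 with rfl | ht0
    · exact h0
    · exact ht ht0

/-! ### Solutions as quotients of analytic functions -/

/-- `N i / D` are the coordinates of a solution with initial value `a`, written as a quotient of
functions analytic on `ℝ`. -/
structure IsSolutionFraction (N : ℝ → Fin 3 → ℝ) (D : ℝ → ℝ) (a : Fin 3 → ℝ) : Prop where
  analyticAt_num : ∀ t, AnalyticAt ℝ N t
  analyticAt_den : ∀ t, AnalyticAt ℝ D t
  num_zero : N 0 = a
  den_zero : D 0 = 1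
  wronskian : ∀ t, D t • deriv N t - deriv D t • N t = tetrahedralField (N t)

namespace IsSolutionFraction

variable {N : ℝ → Fin 3 → ℝ} {D : ℝ → ℝ} {a : Fin 3 → ℝ}

lemma hasDerivAt (h : IsSolutionFraction N D a) {t : ℝ} (ht : D t ≠ 0) :
    HasDerivAt (fun r => (D r)⁻¹ • N r) (tetrahedralField ((D t)⁻¹ • N t)) t := by
  have h1 := ((h.analyticAt_den t).differentiableAt.hasDerivAt.inv ht).smul
    (h.analyticAt_num t).differentiableAt.hasDerivAt
  refine h1.congr_deriv ?_
  rw [tetrahedralField_smul, ← h.wronskian]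
  ext i
  simp only [Pi.add_apply, Pi.smul_apply, Pi.sub_apply, smul_eq_mul, Pi.inv_apply]
  field_simp
  ring

lemma eventually_hasDerivAt (h : IsSolutionFraction N D a) :
    ∀ᶠ t in 𝓝 0, HasDerivAt (fun r => (D r)⁻¹ • N r) (tetrahedralField ((D t)⁻¹ • N t)) t := by
  have : ∀ᶠ t in 𝓝 0, D t ≠ 0 :=
    (h.analyticAt_den 0).continuousAt.eventually_ne (by simp [h.den_zero])
  exact this.mono fun t ht => h.hasDerivAt ht

lemma exists_isMeromorphicSolution (h : IsSolutionFraction N D a) :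
    ∃ g, IsMeromorphicSolution g a := by
  set f : ℝ → Fin 3 → ℝ := fun r => (D r)⁻¹ • N r with hf
  have hm : MeromorphicOn f Set.univ := fun t _ =>
    (h.analyticAt_den t).meromorphicAt.inv.smul (h.analyticAt_num t).meromorphicAt
  have hnf := meromorphicNFOn_toMeromorphicNFOn f Set.univ
  have ha : AnalyticAt ℝ f 0 :=
    ((h.analyticAt_den 0).inv (by simp [h.den_zero])).smul (h.analyticAt_num 0)
  have heq : toMeromorphicNFOn f Set.univ =ᶠ[𝓝 0] f :=
    ((hnf (Set.mem_univ 0)).eventuallyEq_nhdsNE_iff_eventuallyEq_nhds ha.meromorphicNFAt).1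
      (hm.toMeromorphicNFOn_eq_self_on_nhdsNE (Set.mem_univ 0))
  refine ⟨toMeromorphicNFOn f Set.univ, fun t => hnf (Set.mem_univ t), ha.congr heq.symm, ?_, ?_⟩
  · rw [heq.self_of_nhds]
    simp [hf, h.den_zero, h.num_zero]
  · filter_upwards [h.eventually_hasDerivAt, heq.eventuallyEq_nhds] with t ht het
    rw [het.self_of_nhds]
    exact ht.congr_of_eventuallyEq het

/-- A tetrahedral superflow is given, at its regular points, by any solution written as a
fraction. -/
lemma superflow_eq (h : IsSolutionFraction N D a) {φ : (Fin 3 → ℝ) → (Fin 3 → ℝ)}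
    (hφ : IsTetrahedralSuperflow φ) :
    (D 1 ≠ 0 → a ∈ regularSet φ) ∧ (a ∈ regularSet φ → D 1 • φ a = N 1) := by
  have hg := hφ.isMeromorphicSolution a
  set g := Function.update (fun t : ℝ => (1 / t) • φ (t • a)) 0 a with hgdef
  have hgne : ∀ t, t ≠ 0 → g t = (1 / t) • φ (t • a) := fun t ht => by
    simp [hgdef, Function.update_of_ne ht]
  -- Cleared of denominators, the identity passes from 0 to 1 even if `D` vanishes in between.
  have hDN : (fun t => D t • g t - N t) =ᶠ[𝓝[≠] 1] 0 := by
    refine eventuallyEq_zero_of_meromorphic (u := 0) (fun t => ?_) ?_ 1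
    · exact ((h.analyticAt_den t).meromorphicAt.smul (hg.meromorphicAt t)).sub
        (h.analyticAt_num t).meromorphicAt
    · have h0 : g =ᶠ[𝓝 0] fun r => (D r)⁻¹ • N r :=
        tetrahedralField_solution_unique hg.hasDerivAt h.eventually_hasDerivAt
          (by simp [hg.apply_zero, h.den_zero, h.num_zero])
      filter_upwards [h0,
        (h.analyticAt_den 0).continuousAt.eventually_ne (show D 0 ≠ 0 by simp [h.den_zero])]
        with t ht hD
      simp [ht, smul_smul, hD]
  have hφg : (fun t : ℝ => φ (t • a)) =ᶠ[𝓝 1] fun t => t • g t := by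
    filter_upwards [isOpen_ne.mem_nhds (one_ne_zero (α := ℝ))] with t ht
    rw [hgne t ht, smul_smul, mul_one_div_cancel ht, one_smul]
  constructor
  · intro hD
    have hf : AnalyticAt ℝ (fun r => (D r)⁻¹ • N r) 1 :=
      ((h.analyticAt_den 1).inv hD).smul (h.analyticAt_num 1)
    have heq : g =ᶠ[𝓝[≠] 1] fun r => (D r)⁻¹ • N r := by
      filter_upwards [hDN, ((h.analyticAt_den 1).continuousAt.eventually_ne hD).filter_mono
        nhdsWithin_le_nhds] with t ht hDt
      rw [← sub_eq_zero.1 ht, smul_smul, inv_mul_cancel₀ hDt, one_smul]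
    have heq' := ((hg.meromorphicNFAt 1).eventuallyEq_nhdsNE_iff_eventuallyEq_nhds
      hf.meromorphicNFAt).1 heq
    exact (analyticAt_id.smul (hf.congr heq'.symm)).congr hφg.symm
  · intro ha
    have ha : AnalyticAt ℝ (fun t : ℝ => φ (t • a)) 1 := ha
    have hga : ContinuousAt g 1 := by
      have hi : ContinuousAt (fun t : ℝ => (1 / t) • φ (t • a)) 1 :=
        (continuousAt_const.div continuousAt_id one_ne_zero).smul ha.continuousAt
      refine hi.congr ?_
      filter_upwards [isOpen_ne.mem_nhds (one_ne_zero (α := ℝ))] with t ht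
      exact (hgne t ht).symm
    have hc : ContinuousAt (fun t => D t • g t - N t) 1 :=
      ((h.analyticAt_den 1).continuousAt.smul hga).sub (h.analyticAt_num 1).continuousAt
    have := ((hc.eventuallyEq_nhds_iff_eventuallyEq_nhdsNE
      continuousAt_const).1 hDN).self_of_nhds
    have h1 := hφg.self_of_nhds
    simp only [one_smul] at h1
    rw [h1]
    exact sub_eq_zero.1 this

/-- The factor `c` allows for a stated fraction that is not normalised by `D 0 = 1`. -/
lemma superflow_fst_eq (h : IsSolutionFraction N D a) {φ : (Fin 3 → ℝ) → (Fin 3 → ℝ)}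
    (hφ : IsTetrahedralSuperflow φ) {N' D' : ℝ} (c : ℝ) (hD : D' = c * D 1)
    (hN : N' = c * N 1 0) :
    (D' ≠ 0 → a ∈ regularSet φ ∧ φ a 0 = N' / D') ∧ (a ∈ regularSet φ → φ a 0 * D' = N') := by
  obtain ⟨h1, h2⟩ := h.superflow_eq hφ
  have h3 : a ∈ regularSet φ → φ a 0 * D' = N' := fun ha => by
    have := congrFun (h2 ha) 0
    rw [hD, hN, ← this, Pi.smul_apply, smul_eq_mul]
    ring
  refine ⟨fun hD' => ?_, h3⟩
  have ha := h1 (right_ne_zero_of_mul (hD ▸ hD'))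
  exact ⟨ha, eq_div_of_mul_eq hD' (h3 ha)⟩

end IsSolutionFraction

/-! ### Analyticity of the Jacobi functions -/

/-- On a small disc `c` has a holomorphic primitive, and `F` differs from its real part by a
constant. Used for the elliptic integral. -/
lemma analyticAt_of_hasDerivAt_re {F : ℝ → ℝ} {f : ℝ → ℝ} {c : ℂ → ℂ} {x : ℝ}
    (hF : ∀ t, HasDerivAt F (f t) t) (hc : AnalyticAt ℂ c x)
    (hcf : ∀ t : ℝ, (c t).re = f t) : AnalyticAt ℝ F x := by
  obtain ⟨ε, hε, hball⟩ := Metric.eventually_nhds_iff_ball.1 hc.eventually_analyticAt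
  obtain ⟨P, hP⟩ := DifferentiableOn.isExactOn_ball
    (fun z hz => (hball z hz).differentiableAt.differentiableWithinAt)
  have hmem : ∀ t ∈ Metric.ball x ε, (t : ℂ) ∈ Metric.ball (x : ℂ) ε := fun t ht => by
    rw [Metric.mem_ball, Complex.dist_eq, ← Complex.ofReal_sub, Complex.norm_real]
    exact ht
  have hPa : AnalyticAt ℂ P x := by
    refine DifferentiableOn.analyticAt (s := Metric.ball (x : ℂ) ε)
      (fun z hz => (hP z hz).differentiableAt.differentiableWithinAt)
      (Metric.ball_mem_nhds _ hε)
  have hR : AnalyticAt ℝ (fun t : ℝ => (P t).re) x :=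
    (Complex.reCLM.analyticAt _).comp
      ((hPa.restrictScalars (𝕜 := ℝ)).comp (Complex.ofRealCLM.analyticAt x))
  have hRd : ∀ t ∈ Metric.ball x ε, HasDerivAt (fun t : ℝ => (P t).re) (f t) t := fun t ht => by
    rw [← hcf]
    exact (hP t (hmem t ht)).real_of_complex
  have hconst : ∀ t ∈ Metric.ball x ε, F t - (P t).re = F x - (P x).re := fun t ht => by
    refine (Metric.isOpen_ball.is_const_of_deriv_eq_zero (f := fun t => F t - (P t).re)
      (convex_ball x ε).isPreconnected ?_ ?_ ht (Metric.mem_ball_self hε))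
    · exact fun t ht => ((hF t).sub (hRd t ht)).differentiableAt.differentiableWithinAt
    · exact fun t ht => (((hF t).sub (hRd t ht)).congr_deriv (sub_self _)).deriv
  refine (hR.add (analyticAt_const (v := F x - (P x).re))).congr ?_
  filter_upwards [Metric.ball_mem_nhds x hε] with t ht
  simp only [Pi.add_apply, ← hconst t ht]
  ring

section Jacobi

variable {k : ℝ}

lemma one_sub_sq_mul_sin_sq_pos (hk0 : 0 ≤ k) (hk1 : k < 1) (α : ℝ) :
    0 < 1 - k ^ 2 * Real.sin α ^ 2 := by
  have h1 : k ^ 2 < 1 := by nlinarith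
  nlinarith [Real.sin_sq_le_one α, sq_nonneg k, sq_nonneg (Real.sin α)]

lemma hasDerivAt_ellipticF (hk0 : 0 ≤ k) (hk1 : k < 1) (θ : ℝ) :
    HasDerivAt (ellipticF k) (1 / √(1 - k ^ 2 * Real.sin θ ^ 2)) θ := by
  have hc : Continuous fun α : ℝ => 1 / √(1 - k ^ 2 * Real.sin α ^ 2) :=
    continuous_const.div (by fun_prop)
      fun α => (Real.sqrt_pos.2 (one_sub_sq_mul_sin_sq_pos hk0 hk1 α)).ne'
  exact hc.integral_hasStrictDerivAt 0 θ |>.hasDerivAt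

lemma analyticAt_ellipticF (hk0 : 0 ≤ k) (hk1 : k < 1) (θ : ℝ) :
    AnalyticAt ℝ (ellipticF k) θ := by
  have hre : ∀ t : ℝ, (1 - (k : ℂ) ^ 2 * Complex.sin t ^ 2) =
      ((1 - k ^ 2 * Real.sin t ^ 2 : ℝ) : ℂ) := fun t => by push_cast; ring
  refine analyticAt_of_hasDerivAt_re
    (c := fun z => (1 - (k : ℂ) ^ 2 * Complex.sin z ^ 2) ^ (-(1 / 2) : ℂ))
    (hasDerivAt_ellipticF hk0 hk1) ?_ ?_
  · refine AnalyticAt.cpow (by fun_prop) analyticAt_const ?_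
    rw [hre]
    exact Complex.ofReal_mem_slitPlane.2 (one_sub_sq_mul_sin_sq_pos hk0 hk1 θ)
  · intro t
    have hp := one_sub_sq_mul_sin_sq_pos hk0 hk1 t
    rw [hre, show (-(1 / 2) : ℂ) = ((-(1 / 2) : ℝ) : ℂ) by push_cast; ring,
      ← Complex.ofReal_cpow hp.le, Complex.ofReal_re, Real.rpow_neg hp.le, ← Real.sqrt_eq_rpow,
      one_div]

lemma ellipticF_strictMono (hk0 : 0 ≤ k) (hk1 : k < 1) : StrictMono (ellipticF k) :=
  strictMono_of_deriv_pos fun θ => by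
    rw [(hasDerivAt_ellipticF hk0 hk1 θ).deriv]
    exact one_div_pos.2 (Real.sqrt_pos.2 (one_sub_sq_mul_sin_sq_pos hk0 hk1 θ))

lemma ellipticF_zero : ellipticF k 0 = 0 := by simp [ellipticF]

/-- The integrand is at least 1; the resulting linear growth gives surjectivity. -/
lemma ellipticF_sub_self_monotone (hk0 : 0 ≤ k) (hk1 : k < 1) :
    Monotone fun θ => ellipticF k θ - θ := by
  have hd := fun θ => (hasDerivAt_ellipticF hk0 hk1 θ).sub (hasDerivAt_id θ)
  refine monotone_of_deriv_nonneg (fun θ => (hd θ).differentiableAt) fun θ => ?_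
  refine le_of_le_of_eq ?_ (hd θ).deriv.symm
  have hp := Real.sqrt_pos.2 (one_sub_sq_mul_sin_sq_pos hk0 hk1 θ)
  have h1 : √(1 - k ^ 2 * Real.sin θ ^ 2) ≤ 1 :=
    Real.sqrt_le_one.2 (by nlinarith [mul_nonneg (sq_nonneg k) (sq_nonneg (Real.sin θ))])
  have := one_le_one_div hp h1
  linarith

lemma ellipticF_surjective (hk0 : 0 ≤ k) (hk1 : k < 1) : Function.Surjective (ellipticF k) := by
  have hm := ellipticF_sub_self_monotone hk0 hk1
  have hc : Continuous (ellipticF k) :=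
    continuous_iff_continuousAt.2 fun θ => (hasDerivAt_ellipticF hk0 hk1 θ).continuousAt
  refine hc.surjective (tendsto_atTop_mono' _ ?_ tendsto_id) (tendsto_atBot_mono' _ ?_ tendsto_id)
  · filter_upwards [eventually_ge_atTop 0] with θ hθ
    have := hm hθ
    simp only [ellipticF_zero, sub_zero, id] at this ⊢
    linarith
  · filter_upwards [eventually_le_atBot 0] with θ hθ
    have := hm hθ
    simp only [ellipticF_zero, sub_zero, id] at this ⊢
    linarith

lemma jacobiAm_ellipticF (hk0 : 0 ≤ k) (hk1 : k < 1) (θ : ℝ) :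
    jacobiAm k (ellipticF k θ) = θ :=
  Function.leftInverse_invFun (ellipticF_strictMono hk0 hk1).injective θ

lemma jacobiAm_zero (hk0 : 0 ≤ k) (hk1 : k < 1) : jacobiAm k 0 = 0 := by
  simpa [ellipticF_zero] using jacobiAm_ellipticF hk0 hk1 0

lemma analyticAt_jacobiAm (hk0 : 0 ≤ k) (hk1 : k < 1) (u : ℝ) : AnalyticAt ℝ (jacobiAm k) u := by
  obtain ⟨θ, rfl⟩ := ellipticF_surjective hk0 hk1 u
  refine (analyticAt_comp_iff_of_deriv_ne_zero (analyticAt_ellipticF hk0 hk1 θ) ?_).1 ?_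
  · rw [(hasDerivAt_ellipticF hk0 hk1 θ).deriv]
    exact (one_div_pos.2 (Real.sqrt_pos.2 (one_sub_sq_mul_sin_sq_pos hk0 hk1 θ))).ne'
  · rw [show jacobiAm k ∘ ellipticF k = id from funext (jacobiAm_ellipticF hk0 hk1)]
    exact analyticAt_id

lemma hasDerivAt_jacobiAm (hk0 : 0 ≤ k) (hk1 : k < 1) (u : ℝ) :
    HasDerivAt (jacobiAm k) (√(1 - k ^ 2 * jacobiSn u k ^ 2)) u := by
  obtain ⟨θ, rfl⟩ := ellipticF_surjective hk0 hk1 u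
  have hp := Real.sqrt_pos.2 (one_sub_sq_mul_sin_sq_pos hk0 hk1 θ)
  have h1 := (analyticAt_jacobiAm hk0 hk1 (ellipticF k θ)).differentiableAt.hasDerivAt
  have h2 := h1.comp θ (hasDerivAt_ellipticF hk0 hk1 θ)
  rw [show jacobiAm k ∘ ellipticF k = id from funext (jacobiAm_ellipticF hk0 hk1)] at h2
  have h3 := h2.unique (hasDerivAt_id θ)
  rw [jacobiSn, jacobiAm_ellipticF hk0 hk1]
  refine h1.congr_deriv ?_
  field_simp at h3
  exact h3

lemma hasDerivAt_jacobiSn (hk0 : 0 ≤ k) (hk1 : k < 1) (u : ℝ) :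
    HasDerivAt (fun w => jacobiSn w k)
      (Real.cos (jacobiAm k u) * √(1 - k ^ 2 * jacobiSn u k ^ 2)) u :=
  (hasDerivAt_jacobiAm hk0 hk1 u).sin

lemma jacobiSn'_eq (hk0 : 0 ≤ k) (hk1 : k < 1) (u : ℝ) :
    jacobiSn' u k = Real.cos (jacobiAm k u) * √(1 - k ^ 2 * jacobiSn u k ^ 2) :=
  (hasDerivAt_jacobiSn hk0 hk1 u).deriv

end Jacobi

/-! ### Elliptic triples -/

/-- Functions analytic on `ℝ` that parametrize `C² + A S² = 1`, `E² + B S² = 1`, as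
`sn`, `cn`, `dn` do. -/
structure IsEllipticTriple (A B : ℝ) (S C E : ℝ → ℝ) : Prop where
  analyticAt_S : ∀ t, AnalyticAt ℝ S t
  analyticAt_C : ∀ t, AnalyticAt ℝ C t
  analyticAt_E : ∀ t, AnalyticAt ℝ E t
  S_zero : S 0 = 0
  C_zero : C 0 = 1
  E_zero : E 0 = 1
  hasDerivAt_S : ∀ t, HasDerivAt S (C t * E t) t
  hasDerivAt_C : ∀ t, HasDerivAt C (-(A * S t * E t)) t
  hasDerivAt_E : ∀ t, HasDerivAt E (-(B * S t * C t)) t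
  C_sq : ∀ t, C t ^ 2 = 1 - A * S t ^ 2
  E_sq : ∀ t, E t ^ 2 = 1 - B * S t ^ 2

lemma IsEllipticTriple.symm {A B : ℝ} {S C E : ℝ → ℝ} (h : IsEllipticTriple A B S C E) :
    IsEllipticTriple B A S E C where
  analyticAt_S := h.analyticAt_S
  analyticAt_C := h.analyticAt_E
  analyticAt_E := h.analyticAt_C
  S_zero := h.S_zero
  C_zero := h.E_zero
  E_zero := h.C_zero
  hasDerivAt_S t := by simpa only [mul_comm] using h.hasDerivAt_S t
  hasDerivAt_C := h.hasDerivAt_E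
  hasDerivAt_E := h.hasDerivAt_C
  C_sq := h.E_sq
  E_sq := h.C_sq

lemma isEllipticTriple_zero :
    IsEllipticTriple 0 0 (fun t => t) (fun _ => 1) (fun _ => 1) where
  analyticAt_S _ := analyticAt_id
  analyticAt_C _ := analyticAt_const
  analyticAt_E _ := analyticAt_const
  S_zero := rfl
  C_zero := rfl
  E_zero := rfl
  hasDerivAt_S t := (hasDerivAt_id' t).congr_deriv (by simp)
  hasDerivAt_C t := by simpa using hasDerivAt_const t (1 : ℝ)
  hasDerivAt_E t := by simpa using hasDerivAt_const t (1 : ℝ)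
  C_sq _ := by simp
  E_sq _ := by simp

/-- Rescaling the argument of an elliptic triple. -/
lemma IsEllipticTriple.rescale {A B v : ℝ} {S C E : ℝ → ℝ} (h : IsEllipticTriple A B S C E)
    (hv : v ≠ 0) :
    IsEllipticTriple (v ^ 2 * A) (v ^ 2 * B) (fun t => S (v * t) / v) (fun t => C (v * t))
      (fun t => E (v * t)) where
  analyticAt_S t := ((h.analyticAt_S (v * t)).fun_comp (by fun_prop)).fun_div analyticAt_const hv
  analyticAt_C t := (h.analyticAt_C (v * t)).fun_comp (by fun_prop)
  analyticAt_E t := (h.analyticAt_E (v * t)).fun_comp (by fun_prop)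
  S_zero := by simp [h.S_zero]
  C_zero := by simp [h.C_zero]
  E_zero := by simp [h.E_zero]
  hasDerivAt_S t := by
    have := ((h.hasDerivAt_S (v * t)).comp t ((hasDerivAt_id t).const_mul v)).div_const v
    exact this.congr_deriv (by field_simp)
  hasDerivAt_C t := by
    have := (h.hasDerivAt_C (v * t)).comp t ((hasDerivAt_id t).const_mul v)
    exact this.congr_deriv (by field_simp)
  hasDerivAt_E t := by
    have := (h.hasDerivAt_E (v * t)).comp t ((hasDerivAt_id t).const_mul v)
    exact this.congr_deriv (by field_simp)
  C_sq t := by rw [h.C_sq]; field_simp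
  E_sq t := by rw [h.E_sq]; field_simp

lemma isEllipticTriple_trigonometric :
    IsEllipticTriple 1 0 Real.sin Real.cos (fun _ => 1) where
  analyticAt_S _ := by fun_prop
  analyticAt_C _ := by fun_prop
  analyticAt_E _ := analyticAt_const
  S_zero := Real.sin_zero
  C_zero := Real.cos_zero
  E_zero := rfl
  hasDerivAt_S t := by simpa using Real.hasDerivAt_sin t
  hasDerivAt_C t := by simpa using Real.hasDerivAt_cos t
  hasDerivAt_E t := by simpa using hasDerivAt_const t (1 : ℝ)
  C_sq t := by rw [Real.cos_sq']; ring
  E_sq _ := by simp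

/-- The degenerate modulus 1, where sn, cn, dn become tanh, sech, sech; the Jacobi lemmas require `k
< 1`. -/
lemma isEllipticTriple_hyperbolic :
    IsEllipticTriple 1 1 (fun t => Real.sinh t / Real.cosh t) (fun t => 1 / Real.cosh t)
      (fun t => 1 / Real.cosh t) := by
  have hC : ∀ t, HasDerivAt (fun t => 1 / Real.cosh t)
      (-(1 * (Real.sinh t / Real.cosh t) * (1 / Real.cosh t))) t := fun t => by
    have hc := (Real.cosh_pos t).ne'
    have := (hasDerivAt_const t (1 : ℝ)).div (Real.hasDerivAt_cosh t) hc
    exact this.congr_deriv (by field_simp; ring)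
  have hsq : ∀ t, (1 / Real.cosh t) ^ 2 = 1 - 1 * (Real.sinh t / Real.cosh t) ^ 2 := fun t => by
    have hc := (Real.cosh_pos t).ne'
    have := Real.cosh_sq t
    field_simp
    linarith
  have ha : ∀ t, AnalyticAt ℝ (fun t => 1 / Real.cosh t) t := fun t =>
    analyticAt_const.fun_div Real.analyticAt_cosh (Real.cosh_pos t).ne'
  refine ⟨fun t => Real.analyticAt_sinh.fun_div Real.analyticAt_cosh (Real.cosh_pos t).ne',
    ha, ha, by simp, by simp, by simp, fun t => ?_, hC, hC, hsq, hsq⟩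
  have hc := (Real.cosh_pos t).ne'
  have := (Real.hasDerivAt_sinh t).div (Real.hasDerivAt_cosh t) hc
  refine this.congr_deriv ?_
  have := Real.cosh_sq t
  field_simp
  linarith

lemma isEllipticTriple_jacobi {k : ℝ} (hk0 : 0 ≤ k) (hk1 : k < 1) :
    IsEllipticTriple 1 (k ^ 2) (fun u => jacobiSn u k) (fun u => Real.cos (jacobiAm k u))
      (fun u => √(1 - k ^ 2 * jacobiSn u k ^ 2)) := by
  have hpos : ∀ u, 0 < 1 - k ^ 2 * jacobiSn u k ^ 2 := fun u =>
    one_sub_sq_mul_sin_sq_pos hk0 hk1 (jacobiAm k u)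
  have hS : ∀ u, AnalyticAt ℝ (fun u => jacobiSn u k) u := fun u =>
    Real.analyticAt_sin.fun_comp (analyticAt_jacobiAm hk0 hk1 u)
  have hdE : ∀ u, HasDerivAt (fun u => √(1 - k ^ 2 * jacobiSn u k ^ 2))
      (-(k ^ 2 * jacobiSn u k * Real.cos (jacobiAm k u))) u := fun u => by
    have h1 := (((hasDerivAt_jacobiSn hk0 hk1 u).pow 2).const_mul (k ^ 2)).const_sub 1
    have h2 := h1.sqrt (hpos u).ne'
    refine h2.congr_deriv ?_
    have := Real.sqrt_pos.2 (hpos u)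
    simp only [Pi.pow_apply]
    field_simp
    norm_num
    ring
  refine ⟨hS, fun u => Real.analyticAt_cos.fun_comp (analyticAt_jacobiAm hk0 hk1 u), fun u => ?_,
    ?_, ?_, ?_, hasDerivAt_jacobiSn hk0 hk1, fun u => ?_, hdE, fun u => ?_, fun u => ?_⟩
  · exact (Real.contDiffAt_sqrt (hpos u).ne').analyticAt.fun_comp
      (f := fun u => 1 - k ^ 2 * jacobiSn u k ^ 2)
      (analyticAt_const.fun_sub (analyticAt_const.fun_mul ((hS u).fun_pow 2)))
  · simp [jacobiSn, jacobiAm_zero hk0 hk1]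
  · simp [jacobiAm_zero hk0 hk1]
  · simp [jacobiSn, jacobiAm_zero hk0 hk1]
  · exact (hasDerivAt_jacobiAm hk0 hk1 u).cos.congr_deriv (by simp [jacobiSn])
  · simp only [jacobiSn, Real.cos_sq']
    ring
  · exact Real.sq_sqrt (hpos u).le

lemma exists_isEllipticTriple {A B : ℝ} (hA : 0 ≤ A) (hB : 0 ≤ B) :
    ∃ S C E, IsEllipticTriple A B S C E := by
  wlog hBA : B ≤ A generalizing A B
  · obtain ⟨S, C, E, h⟩ := this hB hA (le_of_not_ge hBA)
    exact ⟨S, E, C, h.symm⟩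
  rcases hA.eq_or_lt with rfl | hA
  · obtain rfl : B = 0 := le_antisymm hBA hB
    exact ⟨_, _, _, isEllipticTriple_zero⟩
  have hv : √A ≠ 0 := (Real.sqrt_pos.2 hA).ne'
  have hv2 : √A ^ 2 = A := Real.sq_sqrt hA.le
  rcases hBA.eq_or_lt with rfl | hBA
  · have := isEllipticTriple_hyperbolic.rescale hv
    rw [hv2, mul_one] at this
    exact ⟨_, _, _, this⟩
  · have hk1 : √(B / A) < 1 := by
      rw [Real.sqrt_lt' one_pos, one_pow, div_lt_one hA]
      exact hBA
    have := (isEllipticTriple_jacobi (Real.sqrt_nonneg _) hk1).rescale hv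
    rw [hv2, mul_one, Real.sq_sqrt (div_nonneg hB hA.le), mul_div_cancel₀ _ hA.ne'] at this
    exact ⟨_, _, _, this⟩

/-! ### Explicit solutions and the theorem -/

/-- The solution with initial value `(x, y, z)` in terms of an elliptic triple. -/
lemma IsEllipticTriple.isSolutionFraction {x y z : ℝ} {S C E : ℝ → ℝ}
    (h : IsEllipticTriple (x ^ 2 - y ^ 2) (x ^ 2 - z ^ 2) S C E) :
    IsSolutionFraction
      (fun t => ![x * C t * E t + y * z * S t, y * E t + x * z * S t * C t,
        z * C t + x * y * S t * E t])
      (fun t => 1 - x ^ 2 * S t ^ 2) ![x, y, z] where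
  analyticAt_num t := by
    have h1 := h.analyticAt_S t
    have h2 := h.analyticAt_C t
    have h3 := h.analyticAt_E t
    rw [analyticAt_pi_iff]
    intro i
    fin_cases i <;> simp <;> fun_prop
  analyticAt_den t := by
    have h1 := h.analyticAt_S t
    fun_prop
  num_zero := by simp [h.S_zero, h.C_zero, h.E_zero]
  den_zero := by simp [h.S_zero]
  wronskian t := by
    have hS := h.hasDerivAt_S t
    have hC := h.hasDerivAt_C t
    have hE := h.hasDerivAt_E t
    have eC := h.C_sq t
    have eE := h.E_sq t
    have hD : deriv (fun t => 1 - x ^ 2 * S t ^ 2) t = -(2 * x ^ 2 * S t * (C t * E t)) := by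
      have := ((hS.pow 2).const_mul (x ^ 2)).const_sub 1
      refine (this.congr_deriv ?_).deriv
      norm_num
      ring
    have hN : HasDerivAt (fun t => ![x * C t * E t + y * z * S t, y * E t + x * z * S t * C t,
        z * C t + x * y * S t * E t])
        ![x * -((x ^ 2 - y ^ 2) * S t * E t) * E t + x * C t * -((x ^ 2 - z ^ 2) * S t * C t)
            + y * z * (C t * E t),
          y * -((x ^ 2 - z ^ 2) * S t * C t) + (x * z * (C t * E t) * C t
            + x * z * S t * -((x ^ 2 - y ^ 2) * S t * E t)),
          z * -((x ^ 2 - y ^ 2) * S t * E t) + (x * y * (C t * E t) * E t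
            + x * y * S t * -((x ^ 2 - z ^ 2) * S t * C t))] t := by
      rw [hasDerivAt_pi]
      intro i
      fin_cases i
      · exact ((hC.const_mul x).mul hE).add (hS.const_mul (y * z))
      · exact (hE.const_mul y).add ((hS.const_mul (x * z)).mul hC)
      · exact (hC.const_mul z).add ((hS.const_mul (x * y)).mul hE)
    rw [hN.deriv, hD]
    ext i
    fin_cases i
    · simp [tetrahedralField]
      -- The Wronskian identity is polynomial modulo the relations for C² and E²; the coefficients
      -- come from eliminating these squares.
      linear_combination
        (-x * S t * (x ^ 2 - z ^ 2) * (1 - x ^ 2 * S t ^ 2) - x * z ^ 2 * S t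
          + 2 * x ^ 3 * S t * E t ^ 2) * eC
        + (-x * S t * (x ^ 2 - y ^ 2) * (1 - x ^ 2 * S t ^ 2) - x * y ^ 2 * S t
          + 2 * x ^ 3 * S t * (1 - (x ^ 2 - y ^ 2) * S t ^ 2)) * eE
    · simp [tetrahedralField]
      linear_combination (x ^ 3 * z * S t ^ 2 * E t) * eC + (x ^ 2 * y * S t * C t) * eE
    · simp [tetrahedralField]
      linear_combination (x ^ 2 * z * S t * E t) * eC + (x ^ 3 * y * S t ^ 2 * C t) * eE

/-- Cyclic symmetry of the tetrahedral field. -/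
lemma IsSolutionFraction.rotate {N : ℝ → Fin 3 → ℝ} {D : ℝ → ℝ} {a : Fin 3 → ℝ}
    (h : IsSolutionFraction N D a) (j : Fin 3) :
    IsSolutionFraction (fun t i => N t (i + j)) D (fun i => a (i + j)) where
  analyticAt_num t := analyticAt_pi_iff.2 fun i => analyticAt_pi_iff.1 (h.analyticAt_num t) (i + j)
  analyticAt_den := h.analyticAt_den
  num_zero := by simp [h.num_zero]
  den_zero := h.den_zero
  wronskian t := by
    have hd : deriv (fun t i => N t (i + j)) t = fun i => deriv N t (i + j) :=
      (hasDerivAt_pi.2 fun i => hasDerivAt_pi.1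
        (h.analyticAt_num t).differentiableAt.hasDerivAt (i + j)).deriv
    ext i
    have := congrFun (h.wronskian t) (i + j)
    rw [hd]
    simp only [tetrahedralField_apply, Pi.sub_apply, Pi.smul_apply] at this ⊢
    rw [this, add_right_comm, add_right_comm i j 2]

lemma exists_isMeromorphicSolution (a : Fin 3 → ℝ) : ∃ g, IsMeromorphicSolution g a := by
  have key : ∀ b : Fin 3 → ℝ, b 1 ^ 2 ≤ b 0 ^ 2 → b 2 ^ 2 ≤ b 0 ^ 2 →
      ∃ N D, IsSolutionFraction N D b := fun b h1 h2 => by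
    obtain ⟨S, C, E, h⟩ := exists_isEllipticTriple (sub_nonneg.2 h1) (sub_nonneg.2 h2)
    have := h.isSolutionFraction
    rw [show ![b 0, b 1, b 2] = b by ext i; fin_cases i <;> rfl] at this
    exact ⟨_, _, this⟩
  -- With the largest square in position 0, both parameters of the triple are nonnegative.
  obtain ⟨j, hj⟩ := Finite.exists_max fun i => a i ^ 2
  obtain ⟨N, D, h⟩ := key (fun i => a (i + j)) (by simpa using hj _) (by simpa using hj _)
  have := h.rotate (-j)
  simp only [neg_add_cancel_right] at this
  exact this.exists_isMeromorphicSolution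

theorem mainTheorem4 :
    (∃ φ : (Fin 3 → ℝ) → (Fin 3 → ℝ), IsTetrahedralSuperflow φ) ∧
    ∀ φ : (Fin 3 → ℝ) → (Fin 3 → ℝ), IsTetrahedralSuperflow φ →
      (∀ x y z : ℝ, y ^ 2 < z ^ 2 → z ^ 2 < x ^ 2 →
        let v : ℝ := √(x ^ 2 - y ^ 2)
        let k : ℝ := √((x ^ 2 - z ^ 2) / (x ^ 2 - y ^ 2))
        let N : ℝ := x * (x ^ 2 - y ^ 2) * jacobiSn' v k + y * z * v * jacobiSn v k
        let D : ℝ := x ^ 2 - y ^ 2 - x ^ 2 * jacobiSn v k ^ 2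
        (D ≠ 0 → ![x, y, z] ∈ regularSet φ ∧ φ ![x, y, z] 0 = N / D) ∧
        (![x, y, z] ∈ regularSet φ → φ ![x, y, z] 0 * D = N)) ∧
      (∀ x y : ℝ, y ^ 2 < x ^ 2 →
        let v : ℝ := √(x ^ 2 - y ^ 2)
        let N : ℝ := x * (x ^ 2 - y ^ 2) * Real.cos v + x * y * v * Real.sin v
        let D : ℝ := x ^ 2 * Real.cos v ^ 2 - y ^ 2
        (D ≠ 0 → ![x, y, x] ∈ regularSet φ ∧ φ ![x, y, x] 0 = N / D) ∧
        (![x, y, x] ∈ regularSet φ → φ ![x, y, x] 0 * D = N)) := by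
  refine ⟨exists_isTetrahedralSuperflow exists_isMeromorphicSolution, fun φ hφ => ⟨?_, ?_⟩⟩
  · intro x y z hyz hzx v k N D
    have hA : 0 < x ^ 2 - y ^ 2 := by linarith
    have hB : 0 < x ^ 2 - z ^ 2 := by linarith
    have hv : v ≠ 0 := (Real.sqrt_pos.2 hA).ne'
    have hv2 : v ^ 2 = x ^ 2 - y ^ 2 := Real.sq_sqrt hA.le
    have hk0 : 0 ≤ k := Real.sqrt_nonneg _
    have hk1 : k < 1 := by
      rw [Real.sqrt_lt' one_pos, one_pow, div_lt_one hA]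
      linarith
    have hk2 : v ^ 2 * k ^ 2 = x ^ 2 - z ^ 2 := by
      rw [hv2, Real.sq_sqrt (div_nonneg hB.le hA.le), mul_div_cancel₀ _ hA.ne']
    have h := (isEllipticTriple_jacobi hk0 hk1).rescale hv
    rw [mul_one, hk2, hv2] at h
    -- Here S = sn(vt)/v, so the factor v² clears the denominators in 1 - x²S².
    refine h.isSolutionFraction.superflow_fst_eq hφ (v ^ 2) ?_ ?_
    · simp only [D, mul_one, ← hv2]
      field_simp
    · simp only [N, mul_one, jacobiSn'_eq hk0 hk1, ← hv2, Matrix.cons_val_zero]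
      field_simp
  · intro x y hyx v N D
    have hA : 0 < x ^ 2 - y ^ 2 := by linarith
    have hv : v ≠ 0 := (Real.sqrt_pos.2 hA).ne'
    have hv2 : v ^ 2 = x ^ 2 - y ^ 2 := Real.sq_sqrt hA.le
    have h := isEllipticTriple_trigonometric.rescale hv
    -- Since z = x the second parameter is 0, written as x² - x² to match `isSolutionFraction`.
    rw [mul_one, mul_zero, hv2, ← sub_self (x ^ 2)] at h
    refine h.isSolutionFraction.superflow_fst_eq hφ (v ^ 2) ?_ ?_
    · simp only [D, mul_one, Real.cos_sq' v]
      field_simp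
      rw [hv2]
      ring
    · simp only [N, mul_one, ← hv2, Matrix.cons_val_zero]
      field_simp
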